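/- Conventions. A discrete group $\Gamma$ is amenable if there is a finitely additive map $\mu$ from the subsets of $\Gamma$ to $[0,1]$ with $\mu(\Gamma)=1$ that is invariant under left multiplication. Let $X$ be a topological space. A germ of $X$ is an equivalence class $(g,x)$, where $g$ is a homeomorphism between open subsets of $X$ and $x$ belongs to the domain of $g$; here $(g_1,x_1)=(g_2,x_2)$ if and only if $x_1=x_2$ and $g_1$, $g_2$ agree on a neighbourhood of $x_1$. The germ $(g,x)$ has origin $x$ and target $g(x)$; germs are composed by $(g_1,g_2(x))(g_2,x)=(g_1g_2,x)$, and $(g,x)^{-1}=(g^{-1},g(x))$. A groupoid of germs on $X$ is a set of germs that contains the germs of the identity at all points of $X$ and is closed under composition and inversion. The groupoid of germs of a group $G$ of homeomorphisms of $X$ is $\{(g,x): g\in G,\ x\in X\}$. For a groupoid of germs $\mathfrak{K}$, the isotropy group $\mathfrak{K}_x$ is the group of all elements of $\mathfrak{K}$ with origin and target $x$, and the topological full group $[[\mathfrak{K}]]$ is the group of all homeomorphisms $F:X\to X$ such that $(F,x)\in\mathfrak{K}$ for all $x\in X$. For a finitely generated group $G$ of homeomorphisms of $X$ and $x\in X$,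 the orbital Schreier graph $\Gamma(x,G)$ with respect to a finite symmetric generating set $T$ of $G$ has as vertices the points of the orbit $Gx$ and, for all $t\in T$ and $y\in Gx$, an edge from $y$ to $t(y)$. It is recurrent if the simple random walk on it, started at $x$, returns to $x$ with probability $1$, for some finite non-empty symmetric generating set $T$ (the property does not depend on the choice of $T$). Theorem. Let $G$ be a group of homeomorphisms of a topological space $X$, generated by a finite set $S$, and let $\mathfrak{G}$ be its groupoid of germs. Let $\mathfrak{H}$ be a groupoid of germs on $X$. Suppose that the following conditions hold. 1. The group $[[\mathfrak{H}]]$ is amenable. 2. For every $g\in S$ the set of points $x\in X$ such that $(g,x)\notin\mathfrak{H}$ is finite. 3. For every singular point $x\in X$, that is, for every $x$ such that $(g,x)\notin\mathfrak{H}$ for some $g\in G$, the orbital Schreier graph $\Gamma(x,G)$ is recurrent. 4. For every $x\in X$ the isotropy group $\mathfrak{G}_x$ is amenable. Then the group $G$ is amenable. If, moreover, $X$ is compact (not necessarily Hausdorff), then the group $[[\mathfrak{G}]]$ is amenable as well. -/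

import Mathlib

open Set Filter Topology CategoryTheory

/-! ### Amenability -/

/-- An action of a group `G` on a set `Y` is amenable if there is a finitely additive,
`G`-invariant map `m` from the subsets of `Y` to `[0, 1]` with `m Y = 1`. -/
def IsAmenableAction (G Y : Type*) [Group G] [MulAction G Y] : Prop :=
  ∃ m : Set Y → ℝ,
    (∀ A, m A ∈ Icc (0 : ℝ) 1) ∧
    m univ = 1 ∧
    (∀ A B, Disjoint A B → m (A ∪ B) = m A + m B) ∧
    ∀ (g : G) (A : Set Y), m ((fun y => g • y) '' A) = m A

/-- A (discrete) group is amenable if its action on itself by left multiplication is amenable. -/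
def IsAmenableGroup (G : Type*) [Group G] : Prop := IsAmenableAction G G

/-! ### Recurrence of random walks and Schreier graphs -/

/-- For a Markov chain with transition probabilities `P`, `firstHit P y n x` is the probability
that the chain started at `x` visits `y` at time `n + 1` and not at the times `1, …, n`. -/
noncomputable def firstHit {V : Type*} (P : V → V → ℝ) (y : V) : ℕ → V → ℝ
  | 0, x => P x y
  | n + 1, x => ∑' z : {z : V // z ≠ y}, P x z * firstHit P y n z

/-- The state `v` is recurrent: started at `v`, the chain returns to `v` at some positive time
with probability `1`. -/
def IsRecurrentState {V : Type*} (P : V → V → ℝ) (v : V) : Prop :=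
  HasSum (fun n => firstHit P v n v) 1

/-- Transition probabilities of the simple random walk on a directed multigraph with finite
out-degrees: choose one of the edges issuing from the current vertex uniformly at random. -/
noncomputable def simpleRandomWalk (V : Type*) [Quiver V] (v w : V) : ℝ :=
  (Nat.card (v ⟶ w) : ℝ) / Nat.card (Quiver.Star v)

/-- The group of homeomorphisms of `X` acts on `X` by evaluation. -/
instance homeomorphMulAction (X : Type*) [TopologicalSpace X] : MulAction (X ≃ₜ X) X where
  smul g x := g x
  one_smul _ := rfl
  mul_smul _ _ _ := rfl

/-- The Schreier graph of the action of `G` on the orbit of `x`, for a set `T` of elements of `G`: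
the vertices are the points of the orbit, and each `t ∈ T` gives an edge from `y` to `t • y`. -/
abbrev OrbitalSchreierGraph (G : Type*) {Y : Type*} [Group G] [MulAction G Y] (x : Y)
    (T : Finset G) : Type _ :=
  Quiver.SchreierGraph (MulAction.orbit G x) (fun t : T => (t : G))

/-- The orbital Schreier graph of `x` is recurrent: the simple random walk on the Schreier graph
of the action of `G` on the orbit of `x` is recurrent, for some finite symmetric generating set
of `G`.  (Recurrence does not depend on the choice of this set.) -/
def IsRecurrentOrbitalSchreierGraph (G : Type*) {Y : Type*} [Group G] [MulAction G Y]
    (x : Y) : Prop :=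
  ∃ T : Finset G, (∀ t ∈ T, t⁻¹ ∈ T) ∧ Subgroup.closure (T : Set G) = ⊤ ∧
    IsRecurrentState (simpleRandomWalk (OrbitalSchreierGraph G x T))
      (.ofVertex ⟨x, MulAction.mem_orbit_self x⟩)

/-! ### Germs of local homeomorphisms -/

section Germs

variable {X : Type*} [TopologicalSpace X]

/-- Homeomorphisms between open subsets of `X`, defined at `x` and mapping `x` to `y`. -/
abbrev LocalHomeoAt (x y : X) : Type _ :=
  {e : OpenPartialHomeomorph X X // x ∈ e.source ∧ e x = y}

/-- Two local homeomorphisms have the same germ at `x` if they agree on a neighbourhood of `x`. -/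
instance germSetoid (x y : X) : Setoid (LocalHomeoAt x y) where
  r e e' := e.1 =ᶠ[𝓝 x] e'.1
  iseqv := ⟨fun _ => EventuallyEq.rfl, EventuallyEq.symm, EventuallyEq.trans⟩

/-- Germs at `x` of local homeomorphisms of `X` mapping `x` to `y`; that is, germs with origin `x`
and target `y`. -/
def HomeoGerm (x y : X) : Type _ := Quotient (germSetoid x y)

/-- The germ `(g, x)` of a homeomorphism `g` of `X` at a point `x` with `g x = y`. -/
def homeoGerm (g : X ≃ₜ X) {x y : X} (h : g x = y) : HomeoGerm x y :=
  Quotient.mk _ ⟨g.toOpenPartialHomeomorph, mem_univ x, h⟩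

/-- The composition `γ' ∘ γ` of germs. -/
def HomeoGerm.comp {x y z : X} (γ : HomeoGerm x y) (γ' : HomeoGerm y z) : HomeoGerm x z :=
  Quotient.map₂
    (fun (e : LocalHomeoAt x y) (e' : LocalHomeoAt y z) =>
      (⟨e.1.trans e'.1, by
        obtain ⟨e, hx, rfl⟩ := e
        obtain ⟨e', hy, rfl⟩ := e'
        simp [hx, hy]⟩ : LocalHomeoAt x z))
    (by
      rintro ⟨e, hx, rfl⟩ ⟨f, hfx, hf⟩ h ⟨e', hy, rfl⟩ ⟨f', hfy, hf'⟩ h'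
      change e =ᶠ[𝓝 x] f at h
      change e' =ᶠ[𝓝 (e x)] f' at h'
      change e.trans e' =ᶠ[𝓝 x] f.trans f'
      filter_upwards [h, (e.continuousAt hx).eventually h'] with u hu hu'
      simp only [OpenPartialHomeomorph.coe_trans, Function.comp_apply]
      rw [hu', hu])
    γ γ'

/-- The inverse of a germ. -/
def HomeoGerm.symm {x y : X} (γ : HomeoGerm x y) : HomeoGerm y x :=
  Quotient.map
    (fun e : LocalHomeoAt x y =>
      (⟨e.1.symm, by
        obtain ⟨e, hx, rfl⟩ := e
        simp [hx]⟩ : LocalHomeoAt y x))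
    (by
      rintro ⟨e, hx, rfl⟩ ⟨f, hfx, hf⟩ h
      change e =ᶠ[𝓝 x] f at h
      change e.symm =ᶠ[𝓝 (e x)] f.symm
      have hc : Tendsto e.symm (𝓝 (e x)) (𝓝 x) := by
        have := (e.symm.continuousAt (x := e x) (e.map_source hx))
        simpa [ContinuousAt, hx] using this
      filter_upwards [hc.eventually h, hc.eventually (f.open_source.mem_nhds hfx),
        e.open_target.mem_nhds (e.map_source hx)] with u hu hfu heu
      rw [e.right_inv heu] at hu
      conv_rhs => rw [hu]
      exact (f.left_inv hfu).symm)
    γ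

end Germs

/-- The points of `X`, regarded as the objects of the groupoid of germs of all homeomorphisms
between open subsets of `X`. -/
def GermBase (X : Type*) : Type _ := X

/-- The groupoid of germs of all homeomorphisms between open subsets of `X`: a morphism from `x`
to `y` is a germ with origin `x` and target `y`.  A groupoid of germs of homeomorphisms of `X` is a
wide subgroupoid (one that contains all units) of this groupoid. -/
instance allGerms (X : Type*) [TopologicalSpace X] : Groupoid (GermBase X) where
  Hom x y := HomeoGerm (X := X) x y
  id x := homeoGerm (1 : X ≃ₜ X) (x := x) (y := x) rfl
  comp γ γ' := HomeoGerm.comp γ γ'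
  inv γ := HomeoGerm.symm γ
  id_comp {x y} γ := by
    obtain ⟨e, rfl⟩ := Quotient.exists_rep γ
    exact Quotient.sound (EventuallyEq.refl _ _)
  comp_id {x y} γ := by
    obtain ⟨e, rfl⟩ := Quotient.exists_rep γ
    exact Quotient.sound (EventuallyEq.refl _ _)
  assoc {x y z w} γ γ' γ'' := by
    obtain ⟨e, rfl⟩ := Quotient.exists_rep γ
    obtain ⟨e', rfl⟩ := Quotient.exists_rep γ'
    obtain ⟨e'', rfl⟩ := Quotient.exists_rep γ''
    exact Quotient.sound (EventuallyEq.refl _ _)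
  inv_comp {x y} γ := by
    obtain ⟨⟨e, hx, hy⟩, rfl⟩ := Quotient.exists_rep γ
    refine Quotient.sound ?_
    subst hy
    change e.symm.trans e =ᶠ[𝓝 (e x)] id
    filter_upwards [e.open_target.mem_nhds (e.map_source hx)] with u hu
    exact e.right_inv hu
  comp_inv {x y} γ := by
    obtain ⟨⟨e, hx, hy⟩, rfl⟩ := Quotient.exists_rep γ
    refine Quotient.sound ?_
    change e.trans e.symm =ᶠ[@nhds X _ x] id
    filter_upwards [e.open_source.mem_nhds hx] with u hu
    exact e.left_inv hu

section Groupoids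

variable {X : Type*} [TopologicalSpace X]

/-- The groupoid of germs of a group `G` of homeomorphisms of `X`. -/
def germGroupoid (G : Subgroup (X ≃ₜ X)) : Subgroupoid (GermBase X) where
  arrows x y := {γ | ∃ g ∈ G, ∃ h : g x = y, homeoGerm g h = γ}
  inv := by
    rintro x y _ ⟨g, hg, rfl, rfl⟩
    exact ⟨g⁻¹, G.inv_mem hg, g.symm_apply_apply x, Quotient.sound (EventuallyEq.refl _ _)⟩
  mul := by
    rintro x y z _ ⟨g, hg, rfl, rfl⟩ _ ⟨g', hg', rfl, rfl⟩
    exact ⟨g' * g, G.mul_mem hg' hg, rfl, Quotient.sound (EventuallyEq.refl _ _)⟩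

theorem germGroupoid_isWide (G : Subgroup (X ≃ₜ X)) : (germGroupoid G).IsWide :=
  ⟨fun _ => ⟨1, G.one_mem, rfl, rfl⟩⟩

/-- The germ of `g` at `x` belongs to the groupoid of germs `H`. -/
def GermMem (H : Subgroupoid (GermBase X)) (g : X ≃ₜ X) (x : X) : Prop :=
  homeoGerm g rfl ∈ H.arrows x (g x)

/-- The topological full group `[[H]]` of a groupoid of germs `H`: the group of all homeomorphisms
of `X` all of whose germs belong to `H`. -/
def topologicalFullGroup (H : Subgroupoid (GermBase X)) (hH : H.IsWide) : Subgroup (X ≃ₜ X) where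
  carrier := {F | ∀ x : X, GermMem H F x}
  one_mem' x := hH.wide x
  mul_mem' {F F'} hF hF' x := by
    have h := H.mul (hF' x) (hF (F' x))
    have e : homeoGerm (F * F') rfl =
        HomeoGerm.comp (homeoGerm F' (x := x) rfl) (homeoGerm F (x := F' x) rfl) :=
      Quotient.sound (EventuallyEq.refl _ _)
    exact (congrArg (· ∈ H.arrows x (F (F' x))) e).mpr h
  inv_mem' {F} hF x := by
    obtain ⟨y, rfl⟩ := F.surjective x
    have h := H.inv (hF y)
    have key : ∀ (z : X) (hz : F⁻¹ (F y) = z),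
        homeoGerm (F⁻¹) hz ∈ H.arrows (F y) z → GermMem H F⁻¹ (F y) := by
      rintro z rfl hz
      exact hz
    exact key y (F.symm_apply_apply y) h

/-- The isotropy group (group of germs) of a groupoid of germs `H` at `x`: the group of the germs
in `H` with origin and target `x`. -/
abbrev isotropyGroup (H : Subgroupoid (GermBase X)) (hH : H.IsWide) (x : GermBase X) :
    Subgroup (x ⟶ x) :=
  H.vertexSubgroup ⟨_, hH.wide x⟩

/-- A point is singular (for `G`, with respect to `H`) if the germ at it of some element of `G`
does not belong to `H`. -/
def IsSingularPoint (G : Subgroup (X ≃ₜ X)) (H : Subgroupoid (GermBase X)) (x : X) : Prop :=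
  ∃ g ∈ G, ¬ GermMem H g x

end Groupoids

/-!
The group `G` acts on the finite subsets of `X`, and the proof has three ingredients.

*An invariant mean on finite subsets.*  On a recurrent Schreier graph, the probability of hitting
`x` within `n` steps is a finitely supported function that equals `1` at `x`, and its Dirichlet
energy is bounded by the probability of not returning to `x` within `n + 1` steps, hence tends
to `0` (`sum_dirichletEnergy_hitBefore_le`).  Taking maxima gives such functions `a` that equal `1`
on any given finite set of singular points.  Choose each point `y` independently with probability
`sin (π / 2 * a y) ^ 2`.  The Hellinger affinity of two such random subsets is a product of
cosines, so the law of the random subset is almost invariant when the energy of `a` is small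
(`sq_randomSubset_preimage_sub_le`).  In the limit, there is an invariant mean on the finite subsets
of `X` for which almost every set contains any given finite set of singular points
(`exists_mean_of_hasZeroCapacity`).

*A groupoid with amenable isotropy.*  Consider the arrows from `B` to `g B`, where `B` is a finite
subset of `X`, and the germs of `g` outside `B` belong to `H`.  They form a groupoid.  The isotropy
group of `B` is amenable: it permutes the finite set `B`; the elements fixing `B` pointwise have
germs at the points of `B`, which belong to amenable isotropy groups; and an element with trivial
germs on `B` belongs to the topological full group of `H`
(`hasInvariantMean_singularStabilizer`).

*Averaging.*  Any `g` has finitely many singular points, so for almost every `B` the arrow from `B`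
to `g B` belongs to the groupoid.  Transporting invariant means of the isotropy groups along the
groupoid, and integrating them over `B`, gives an invariant mean on the group
(`HasInvariantMean.of_action`).

The argument uses only that each element of the group agrees locally with one of finitely many
elements of `G` (`isAmenableGroup_of_piecewise`).  If `X` is compact, this holds for the topological
full group of the groupoid of germs of `G` as well.
-/

/-! ### Means and integration against them -/

/-- A mean on `Y`: a finitely additive probability measure defined on all subsets of `Y`. -/
def IsMean {Y : Type*} (m : Set Y → ℝ) : Prop :=
  (∀ A, m A ∈ Icc (0 : ℝ) 1) ∧ m univ = 1 ∧ ∀ A B, Disjoint A B → m (A ∪ B) = m A + m B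

namespace IsMean

variable {Y : Type*} {m : Set Y → ℝ}

theorem empty (hm : IsMean m) : m ∅ = 0 := by
  have := hm.2.2 ∅ ∅ (by simp)
  simp at this
  exact this

theorem inter_add_diff (hm : IsMean m) (A N : Set Y) : m (A ∩ N) + m (A \ N) = m A := by
  rw [← hm.2.2 _ _ disjoint_sdiff_inter.symm, inter_union_sdiff]

theorem mono (hm : IsMean m) {A B : Set Y} (h : A ⊆ B) : m A ≤ m B := by
  have h1 := hm.inter_add_diff B A
  rw [inter_eq_right.mpr h] at h1
  linarith [(hm.1 (B \ A)).1]

theorem eq_one_of_superset (hm : IsMean m) {A B : Set Y} (h : A ⊆ B) (hA : m A = 1) :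
    m B = 1 :=
  le_antisymm (hm.1 B).2 (hA ▸ hm.mono h)

theorem inter_of_eq_one (hm : IsMean m) {N : Set Y} (hN : m N = 1) (A : Set Y) :
    m (A ∩ N) = m A := by
  have h1 := hm.inter_add_diff univ N
  have h2 := hm.inter_add_diff A N
  have h3 := hm.mono (show A \ N ⊆ univ \ N from sdiff_subset_sdiff_left (subset_univ A))
  rw [univ_inter, hm.2.1] at h1
  linarith [(hm.1 (A \ N)).1]

theorem preimage_finset (hm : IsMean m) {Q : Type*} (p : Y → Q) (K : Finset Q) :
    m (p ⁻¹' K) = ∑ q ∈ K, m (p ⁻¹' {q}) := by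
  classical
  induction K using Finset.induction_on with
  | empty => simp [hm.empty]
  | insert q K hq ih =>
    rw [Finset.sum_insert hq, ← ih, ← hm.2.2]
    · congr 1
      ext y
      simp
    · rw [Set.disjoint_left]
      rintro y rfl hy
      exact hq (by simpa using hy)

/-- The push-forward of a mean. -/
theorem map (hm : IsMean m) {Z : Type*} (f : Y → Z) : IsMean fun A : Set Z => m (f ⁻¹' A) :=
  ⟨fun A => hm.1 _, by simpa using hm.2.1, fun A B h => by
    simpa only [preimage_union] using hm.2.2 _ _ (h.preimage f)⟩

end IsMean

/-- Along an ultrafilter, every bounded family of real numbers converges. -/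
theorem Ultrafilter.exists_tendsto_Icc {ι : Type*} (U : Ultrafilter ι) {a b : ℝ} {F : ι → ℝ}
    (hF : ∀ i, F i ∈ Icc a b) : ∃ L ∈ Icc a b, Tendsto F U (𝓝 L) := by
  obtain ⟨L, hL, h⟩ := isCompact_Icc.ultrafilter_le_nhds (U.map F)
    (le_principal_iff.mpr (Filter.mem_map.mpr (Filter.univ_mem' hF)))
  exact ⟨L, hL, h⟩

/-- The space of means is compact. -/
theorem exists_isMean_tendsto {ι Y : Type*} (U : Ultrafilter ι) {ν : ι → Set Y → ℝ}
    (hν : ∀ i, IsMean (ν i)) :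
    ∃ m : Set Y → ℝ, IsMean m ∧ ∀ A, Tendsto (fun i => ν i A) U (𝓝 (m A)) := by
  choose m hm hlim using fun A => U.exists_tendsto_Icc (fun i => (hν i).1 A)
  refine ⟨m, ⟨hm, ?_, fun A B h => ?_⟩, hlim⟩
  · refine tendsto_nhds_unique (hlim univ) ?_
    simp only [(hν _).2.1]
    exact tendsto_const_nhds
  · refine tendsto_nhds_unique (hlim (A ∪ B)) ?_
    simp only [(hν _).2.2 A B h]
    exact (hlim A).add (hlim B)

/-- On finitely many sets, a mean agrees with a finitely supported probability measure. -/
theorem IsMean.exists_linearMap {Y : Type*} {m : Set Y → ℝ} (hm : IsMean m)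
    (i : Finset (Set Y)) :
    ∃ E : (Y → ℝ) →ₗ[ℝ] ℝ, (∀ f, 0 ≤ f → 0 ≤ E f) ∧ E 1 = 1 ∧
      ∀ A ∈ i, E (A.indicator 1) = m A := by
  classical
  -- `Q` is the set of atoms of the algebra generated by `i`; the measure puts the mass of each atom
  -- at a representative of it.
  let c : Y → (i → Prop) := fun y A => y ∈ A.1
  let Q := Quotient (Setoid.ker c)
  let p : Y → Q := Quotient.mk _
  have : Finite Q := Finite.of_injective (Setoid.kerLift c) (Setoid.kerLift_injective c)
  have := Fintype.ofFinite Q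
  let E : (Y → ℝ) →ₗ[ℝ] ℝ := ∑ q : Q, m (p ⁻¹' {q}) • LinearMap.proj (R := ℝ) q.out
  have hE : ∀ f, E f = ∑ q : Q, m (p ⁻¹' {q}) * f q.out := fun f => by
    simp [E, LinearMap.sum_apply]
  have hset : ∀ A : Set Y, (∀ y, y ∈ A ↔ (p y).out ∈ A) → E (A.indicator 1) = m A := by
    intro A hA
    have : A = p ⁻¹' (Finset.univ.filter fun q : Q => q.out ∈ A) := by
      ext y
      simp [hA y]
    rw [this, hm.preimage_finset, ← this, hE, Finset.sum_filter]
    refine Finset.sum_congr rfl fun q _ => ?_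
    by_cases hq : q.out ∈ A <;> simp [hq]
  refine ⟨E, fun f hf => ?_, ?_, fun A hA => hset A fun y => ?_⟩
  · rw [hE]
    exact Finset.sum_nonneg fun q _ => mul_nonneg (hm.1 _).1 (hf _)
  · have := hset univ (by simp)
    rwa [indicator_univ, hm.2.1] at this
  · have h : c (p y).out = c y := Quotient.exact (s := Setoid.ker c) (Quotient.out_eq (p y))
    exact (Eq.to_iff (congrFun h ⟨A, hA⟩)).symm

/-- A function with values in `[0, 1]` is within `1 / n` of an average of indicator functions of
its superlevel sets. -/
theorem superlevel_average_bounds {n : ℕ} (hn : 0 < n) {t : ℝ} (ht : t ∈ Icc (0 : ℝ) 1) :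
    (n : ℝ)⁻¹ * ∑ k ∈ Finset.range n, (if ((k + 1 : ℕ) : ℝ) / n ≤ t then (1 : ℝ) else 0) ≤ t ∧
    t ≤ (n : ℝ)⁻¹ * (∑ k ∈ Finset.range n,
      (if ((k + 1 : ℕ) : ℝ) / n ≤ t then (1 : ℝ) else 0)) + (n : ℝ)⁻¹ := by
  have hn' : (0 : ℝ) < n := by exact_mod_cast hn
  have hnt : 0 ≤ n * t := mul_nonneg hn'.le ht.1
  have hfl : ⌊n * t⌋₊ ≤ n := by
    refine Nat.floor_le_of_le ?_
    nlinarith [ht.2]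
  have hs : ∑ k ∈ Finset.range n, (if ((k + 1 : ℕ) : ℝ) / n ≤ t then (1 : ℝ) else 0)
      = ⌊n * t⌋₊ := by
    rw [← Finset.sum_filter, Finset.sum_const, nsmul_eq_mul, mul_one]
    have : Finset.filter (fun k : ℕ => ((k + 1 : ℕ) : ℝ) / n ≤ t) (Finset.range n)
        = Finset.range ⌊n * t⌋₊ := by
      ext k
      rw [Finset.mem_filter, Finset.mem_range, Finset.mem_range, div_le_iff₀ hn', mul_comm t,
        ← Nat.le_floor_iff hnt]
      omega
    rw [this, Finset.card_range]
  rw [hs]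
  have h1 := Nat.floor_le hnt
  have h2 := (Nat.lt_floor_add_one (n * t)).le
  constructor
  · rw [inv_mul_le_iff₀ hn']
    exact h1
  · rw [← mul_add_one, ← div_eq_inv_mul, le_div_iff₀ hn', mul_comm]
    exact h2

/-- Integration of `[0, 1]`-valued functions against a mean.  By the last clause the integral
depends only on the measures of the superlevel sets; this gives both its invariance under
measure-preserving maps and its insensitivity to null sets. -/
theorem IsMean.exists_integral {Y : Type*} {m : Set Y → ℝ} (hm : IsMean m) :
    ∃ I : (Y → ℝ) → ℝ,
      (∀ f, (∀ y, f y ∈ Icc (0 : ℝ) 1) → I f ∈ Icc (0 : ℝ) 1) ∧ I 1 = 1 ∧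
      (∀ f g, (∀ y, f y ∈ Icc (0 : ℝ) 1) → (∀ y, g y ∈ Icc (0 : ℝ) 1) →
        (∀ y, (f + g) y ∈ Icc (0 : ℝ) 1) → I (f + g) = I f + I g) ∧
      ∀ f g, (∀ y, f y ∈ Icc (0 : ℝ) 1) → (∀ y, g y ∈ Icc (0 : ℝ) 1) →
        (∀ c, m {y | c ≤ f y} = m {y | c ≤ g y}) → I f = I g := by
  classical
  choose E hpos hone hset using hm.exists_linearMap
  let U : Ultrafilter (Finset (Set Y)) := Ultrafilter.of atTop
  have hU : (U : Filter (Finset (Set Y))) ≤ atTop := Ultrafilter.of_le _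
  have hmono : ∀ i f g, f ≤ g → E i f ≤ E i g := fun i f g h => by
    have := hpos i (g - f) (sub_nonneg.mpr h)
    rw [map_sub] at this
    linarith
  have hmem : ∀ f : Y → ℝ, (∀ y, f y ∈ Icc (0 : ℝ) 1) → ∀ i, E i f ∈ Icc (0 : ℝ) 1 :=
    fun f hf i => ⟨hpos i f fun y => (hf y).1, by
      rw [← hone i]
      exact hmono i f 1 fun y => (hf y).2⟩
  let I : (Y → ℝ) → ℝ := fun f => limUnder (U : Filter (Finset (Set Y))) fun i => E i f
  have hlim : ∀ f : Y → ℝ, (∀ y, f y ∈ Icc (0 : ℝ) 1) →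
      Tendsto (fun i => E i f) U (𝓝 (I f)) ∧ I f ∈ Icc (0 : ℝ) 1 := fun f hf => by
    obtain ⟨L, hL, h⟩ := U.exists_tendsto_Icc (hmem f hf)
    have : I f = L := h.limUnder_eq
    rw [this]
    exact ⟨h, hL⟩
  refine ⟨I, fun f hf => (hlim f hf).2, ?_, fun f g hf hg hfg => ?_, fun f g hf hg h => ?_⟩
  · refine tendsto_nhds_unique (hlim 1 fun y => by simp).1 ?_
    simp only [hone]
    exact tendsto_const_nhds
  · refine tendsto_nhds_unique (hlim _ hfg).1 ?_
    simp only [map_add]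
    exact (hlim f hf).1.add (hlim g hg).1
  · let φ : (Y → ℝ) → ℕ → Y → ℝ := fun f n =>
      (n : ℝ)⁻¹ • ∑ k ∈ Finset.range n, {y | ((k + 1 : ℕ) : ℝ) / n ≤ f y}.indicator 1
    have hφ : ∀ f n y, φ f n y = (n : ℝ)⁻¹ * ∑ k ∈ Finset.range n,
        (if ((k + 1 : ℕ) : ℝ) / n ≤ f y then (1 : ℝ) else 0) := fun f n y => by
      simp [φ, Set.indicator_apply]
    have hclose : ∀ f : Y → ℝ, (∀ y, f y ∈ Icc (0 : ℝ) 1) → ∀ n : ℕ, 0 < n → ∀ i,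
        E i (φ f n) ≤ E i f ∧ E i f ≤ E i (φ f n) + (n : ℝ)⁻¹ := fun f hf n hn i => by
      refine ⟨hmono i _ _ fun y => ?_, ?_⟩
      · rw [hφ]
        exact (superlevel_average_bounds hn (hf y)).1
      · have := hmono i f (φ f n + (n : ℝ)⁻¹ • 1) fun y => by
          have := (superlevel_average_bounds hn (hf y)).2
          simpa [hφ] using this
        simpa [map_add, map_smul, hone] using this
    have hev : ∀ f n, ∀ᶠ i in (U : Filter (Finset (Set Y))),
        E i (φ f n) = (n : ℝ)⁻¹ * ∑ k ∈ Finset.range n, m {y | ((k + 1 : ℕ) : ℝ) / n ≤ f y} :=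
      fun f n => by
      have h1 : ∀ᶠ i in (atTop : Filter (Finset (Set Y))),
          ((Finset.range n).image fun k : ℕ => {y | ((k + 1 : ℕ) : ℝ) / n ≤ f y}) ⊆ i :=
        eventually_ge_atTop _
      filter_upwards [hU h1] with i hi
      simp only [φ, map_smul, map_sum, smul_eq_mul]
      congr 1
      refine Finset.sum_congr rfl fun k hk => hset i _ (hi ?_)
      exact Finset.mem_image_of_mem _ hk
    have hle : ∀ n : ℕ, 0 < n → |I f - I g| ≤ (n : ℝ)⁻¹ := fun n hn => by
      refine le_of_tendsto ((hlim f hf).1.sub (hlim g hg).1).abs ?_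
      filter_upwards [hev f n, hev g n] with i hi hi'
      have h1 := hclose f hf n hn i
      have h2 := hclose g hg n hn i
      rw [hi] at h1
      rw [hi'] at h2
      simp only [h] at h1
      rw [abs_le]
      constructor <;> linarith
    have h0 : |I f - I g| ≤ 0 := by
      refine ge_of_tendsto (tendsto_inv_atTop_nhds_zero_nat (𝕜 := ℝ)) ?_
      filter_upwards [eventually_gt_atTop 0] with n hn using hle n hn
    linarith [abs_nonpos_iff.mp h0]

/-! ### Permanence properties of amenability -/

section Permanence

variable {A : Type*} [Group A]

/-- There is a mean on the group `A` that is invariant under left multiplication by the elements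
of `K`.  If `K` is a subgroup, this says that `K` is amenable; working with means on a fixed
overgroup makes the notion monotone in `K` and meaningful for arbitrary subsets. -/
def HasInvariantMean (K : Set A) : Prop :=
  ∃ m : Set A → ℝ, IsMean m ∧ ∀ g ∈ K, ∀ B : Set A, m ((g * ·) ⁻¹' B) = m B

theorem HasInvariantMean.mono {K L : Set A} (h : K ⊆ L) (hL : HasInvariantMean L) :
    HasInvariantMean K :=
  let ⟨m, hm, hinv⟩ := hL
  ⟨m, hm, fun g hg => hinv g (h hg)⟩

theorem isAmenableGroup_iff {Q : Type*} [Group Q] :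
    IsAmenableGroup Q ↔ HasInvariantMean (univ : Set Q) := by
  constructor
  · rintro ⟨m, h1, h2, h3, h4⟩
    refine ⟨m, ⟨h1, h2, h3⟩, fun g _ B => ?_⟩
    rw [← h4 g]
    congr 1
    exact image_preimage_eq B (Group.mulLeft_bijective g).surjective
  · rintro ⟨m, ⟨h1, h2, h3⟩, h4⟩
    refine ⟨m, h1, h2, h3, fun g B => ?_⟩
    rw [← h4 g (mem_univ g)]
    congr 1
    exact preimage_image_eq B (Group.mulLeft_bijective g).injective

/-- For a subgroup, a mean on the overgroup restricts to one on the subgroup along the projection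
given by a transversal of the right cosets. -/
theorem isAmenableGroup_coe_iff (K : Subgroup A) :
    IsAmenableGroup K ↔ HasInvariantMean (K : Set A) := by
  rw [isAmenableGroup_iff]
  constructor
  · rintro ⟨m, hm, hinv⟩
    exact ⟨_, hm.map ((↑) : K → A), fun g hg B =>
      hinv ⟨g, hg⟩ (mem_univ _) (((↑) : K → A) ⁻¹' B)⟩
  · rintro ⟨m, hm, hinv⟩
    let r : A → A := fun a => (Quotient.mk (QuotientGroup.rightRel K) a).out
    have hr : ∀ a, a * (r a)⁻¹ ∈ K := fun a =>
      QuotientGroup.rightRel_apply.mp (Quotient.mk_out (s := QuotientGroup.rightRel K) a)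
    have hrk : ∀ (k : K) a, r (k * a) = r a := fun k a => by
      have : Quotient.mk (QuotientGroup.rightRel K) (k * a)
          = Quotient.mk (QuotientGroup.rightRel K) a := by
        refine Quotient.sound (QuotientGroup.rightRel_apply.mpr ?_)
        simp
      simp only [r, this]
    refine ⟨_, hm.map fun a => (⟨a * (r a)⁻¹, hr a⟩ : K), fun g _ B => ?_⟩
    refine Eq.trans (congrArg m ?_) (hinv g g.2 _)
    ext a
    simp only [mem_preimage]
    have : g * (⟨a * (r a)⁻¹, hr a⟩ : K) = ⟨g * a * (r (g * a))⁻¹, hr _⟩ :=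
      Subtype.ext (by simp [hrk, mul_assoc])
    rw [this]

/-- Let a group `Γ` act on `Y` with an invariant mean, and let `D g y` be a subgroupoid of the
action groupoid that contains, for each `g`, the arrow from `y` to `g y` for almost all `y`.  If
the isotropy groups of `D` are amenable, then so is `Γ`.  The proof averages over `y` invariant
means of the isotropy groups, transported along the arrows of `D`. -/
theorem HasInvariantMean.of_action {Γ : Subgroup A} {Y : Type*} (ρ : Γ →* Equiv.Perm Y)
    (D : Γ → Y → Prop) (hone : ∀ y, D 1 y)
    (hmul : ∀ g h y, D g y → D h (ρ g y) → D (h * g) y)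
    (hinv : ∀ g y, D g y → D g⁻¹ (ρ g y))
    {m : Set Y → ℝ} (hm : IsMean m) (hminv : ∀ g B, m (ρ g ⁻¹' B) = m B)
    (hD : ∀ g, m {y | D g y} = 1)
    (hstab : ∀ y, HasInvariantMean ((↑) '' {g : Γ | ρ g y = y ∧ D g y} : Set A)) :
    HasInvariantMean (Γ : Set A) := by
  obtain ⟨I, hI, hI1, hIadd, hIcongr⟩ := hm.exists_integral
  let s : Setoid Y :=
    { r := fun y z => ∃ g, ρ g y = z ∧ D g y
      iseqv :=
        { refl := fun y => ⟨1, by simp, hone y⟩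
          symm := by
            rintro y _ ⟨g, rfl, hg⟩
            exact ⟨g⁻¹, by simp, hinv g y hg⟩
          trans := by
            rintro y _ _ ⟨g, rfl, hg⟩ ⟨h, rfl, hh⟩
            exact ⟨h * g, by simp, hmul g h y hg hh⟩ } }
  let b : Y → Y := fun y => (Quotient.mk s y).out
  have hb : ∀ y, ∃ t, ρ t (b y) = y ∧ D t (b y) := fun y => Quotient.mk_out (s := s) y
  choose t ht htD using hb
  choose κ hκ hκinv using hstab
  let μ : Y → Set A → ℝ := fun y B => κ (b y) (((t y : A) * ·) ⁻¹' B)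
  have hμ : ∀ y, IsMean (μ y) := fun y => (hκ (b y)).map _
  have hμinv : ∀ g y, D g y → ∀ B, μ y (((g : A) * ·) ⁻¹' B) = μ (ρ g y) B := fun g y hg B => by
    have hbg : b (ρ g y) = b y := by
      have : Quotient.mk s (ρ g y) = Quotient.mk s y :=
        (Quotient.sound (show s.r y (ρ g y) from ⟨g, rfl, hg⟩)).symm
      simp only [b, this]
    have h1 := ht (ρ g y)
    have h2 := htD (ρ g y)
    -- The transport to `y` followed by `g` differs from the transport to `g y` by an element `k`
    -- of the isotropy group of the base point.
    have hk : ρ ((t (ρ g y))⁻¹ * (g * t y)) (b y) = b y ∧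
        D ((t (ρ g y))⁻¹ * (g * t y)) (b y) := by
      rw [hbg] at h1 h2
      have h3 : ρ (t (ρ g y))⁻¹ (ρ g y) = b y := by
        rw [map_inv, Equiv.Perm.inv_eq_iff_eq, h1]
      refine ⟨?_, hmul _ _ _ (hmul _ _ _ (htD y) ?_) ?_⟩
      · rw [map_mul, map_mul, Equiv.Perm.mul_apply, Equiv.Perm.mul_apply, ht y, h3]
      · rwa [ht y]
      · rw [map_mul, Equiv.Perm.mul_apply, ht y]
        have := hinv _ _ h2
        rwa [h1] at this
    have := hκinv (b y) _ ⟨_, hk, rfl⟩ (((t (ρ g y) : A) * ·) ⁻¹' B)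
    simp only [μ, hbg]
    rw [← this]
    congr 1
    ext a
    simp [mul_assoc]
  have hμI : ∀ B y, μ y B ∈ Icc (0 : ℝ) 1 := fun B y => (hμ y).1 B
  refine ⟨fun B => I fun y => μ y B, ⟨fun B => hI _ (hμI B), ?_, fun B C h => ?_⟩,
    fun g hg B => ?_⟩
  · simp only [(hμ _).2.1]
    exact hI1
  · simp only [(hμ _).2.2 B C h]
    exact hIadd _ _ (hμI B) (hμI C) fun y => by
      have := hμI (B ∪ C) y
      rwa [(hμ y).2.2 B C h] at this
  · refine hIcongr _ _ (hμI _) (hμI _) fun c => ?_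
    rw [← hminv ⟨g, hg⟩ {y | c ≤ μ y B}, ← hm.inter_of_eq_one (hD ⟨g, hg⟩),
      ← hm.inter_of_eq_one (hD ⟨g, hg⟩) (ρ ⟨g, hg⟩ ⁻¹' _)]
    congr 1
    ext y
    simp only [mem_inter_iff, mem_ofPred_eq, mem_preimage]
    refine and_congr_left fun hy => ?_
    rw [← hμinv ⟨g, hg⟩ y hy B]

/-- Extensions of amenable groups by amenable groups are amenable. -/
theorem HasInvariantMean.of_hom {Γ : Subgroup A} {Q : Type*} [Group Q] (φ : Γ →* Q)
    (hQ : IsAmenableGroup Q) (hker : HasInvariantMean ((↑) '' {g : Γ | φ g = 1} : Set A)) :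
    HasInvariantMean (Γ : Set A) := by
  obtain ⟨m, hm, hinv⟩ := isAmenableGroup_iff.mp hQ
  refine HasInvariantMean.of_action ((MulAction.toPermHom Q Q).comp φ) (fun _ _ => True)
    (fun _ => trivial) (fun _ _ _ _ _ => trivial) (fun _ _ _ => trivial) hm
    (fun g B => hinv (φ g) (mem_univ _) B) (fun g => by simpa using hm.2.1) fun y => ?_
  refine hker.mono (image_mono fun g hg => ?_)
  simpa using hg.1

theorem isAmenableGroup_of_finite (Q : Type*) [Group Q] [Finite Q] : IsAmenableGroup Q := by
  refine isAmenableGroup_iff.mpr ⟨fun B => (B.ncard : ℝ) / Nat.card Q,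
    ⟨fun B => ⟨by positivity, ?_⟩, ?_,
    fun B C h => ?_⟩, fun g _ B => ?_⟩
  · refine div_le_one_of_le₀ ?_ (by positivity)
    exact_mod_cast ncard_le_card B
  · beta_reduce
    rw [ncard_univ, div_self]
    exact_mod_cast Nat.card_pos.ne'
  · beta_reduce
    rw [ncard_union_eq h, Nat.cast_add, add_div]
  · simp only
    rw [ncard_preimage_of_injective_subset_range (Group.mulLeft_bijective g).injective]
    rw [(Group.mulLeft_bijective g).surjective.range_eq]
    exact subset_univ B

end Permanence

/-! ### Random finite subsets -/

section RandomSubset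

variable {X : Type*}

/-- The square root of the probability that a random subset of `D` equals `B`, up to sign, when
each point `y` is chosen independently with probability `sin (θ y) ^ 2`. -/
noncomputable def subsetAmplitude [DecidableEq X] (D : Finset X) (θ : X → ℝ) (B : Finset X) : ℝ :=
  (∏ y ∈ B, Real.sin (θ y)) * ∏ y ∈ D \ B, Real.cos (θ y)

open Classical in
/-- The distribution of a random subset of `D`, when each point `y` is chosen independently with
probability `sin (θ y) ^ 2`. -/
noncomputable def randomSubset (D : Finset X) (θ : X → ℝ) (A : Set (Finset X)) : ℝ :=
  ∑ B ∈ D.powerset, if B ∈ A then subsetAmplitude D θ B ^ 2 else 0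

theorem sum_subsetAmplitude_mul [DecidableEq X] (D : Finset X) (θ η : X → ℝ) :
    ∑ B ∈ D.powerset, subsetAmplitude D θ B * subsetAmplitude D η B
      = ∏ y ∈ D, Real.cos (θ y - η y) := by
  simp only [Real.cos_sub, add_comm (Real.cos _ * Real.cos _)]
  rw [Finset.prod_add]
  refine Finset.sum_congr rfl fun B _ => ?_
  simp only [subsetAmplitude, Finset.prod_mul_distrib]
  ring

theorem isMean_randomSubset (D : Finset X) (θ : X → ℝ) : IsMean (randomSubset D θ) := by
  classical
  have h1 : randomSubset D θ univ = 1 := by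
    have := sum_subsetAmplitude_mul D θ θ
    simp only [sub_self, Real.cos_zero, Finset.prod_const_one, ← pow_two] at this
    simpa [randomSubset] using this
  refine ⟨fun A => ⟨Finset.sum_nonneg fun B _ => ?_, ?_⟩, h1, fun A B h => ?_⟩
  · split_ifs <;> positivity
  · rw [← h1]
    refine Finset.sum_le_sum fun B _ => ?_
    simp only [mem_univ, if_true]
    split_ifs
    · exact le_rfl
    · positivity
  · simp only [randomSubset]
    rw [← Finset.sum_add_distrib]
    refine Finset.sum_congr rfl fun C _ => ?_
    by_cases hA : C ∈ A
    · simp [hA, Set.disjoint_left.mp h hA]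
    · simp [hA]

/-- Points with `θ = 0` are never chosen. -/
theorem randomSubset_eq_of_subset {D D' : Finset X} (h : D ⊆ D') {θ : X → ℝ}
    (hθ : ∀ y, y ∉ D → θ y = 0) (A : Set (Finset X)) :
    randomSubset D' θ A = randomSubset D θ A := by
  classical
  symm
  unfold randomSubset
  refine Finset.sum_subset_zero_on_sdiff (Finset.powerset_mono.mpr h) (fun B hB => ?_)
    fun B hB => ?_
  · rw [Finset.mem_sdiff, Finset.mem_powerset, Finset.mem_powerset] at hB
    obtain ⟨y, hy, hyD⟩ := Finset.not_subset.mp hB.2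
    have : subsetAmplitude D' θ B = 0 := by
      rw [subsetAmplitude, Finset.prod_eq_zero hy (by rw [hθ y hyD, Real.sin_zero]), zero_mul]
    simp [this]
  · have : subsetAmplitude D' θ B = subsetAmplitude D θ B := by
      unfold subsetAmplitude
      congr 1
      symm
      refine Finset.prod_subset (Finset.sdiff_subset_sdiff h le_rfl) fun y hy hy' => ?_
      have hyD : y ∉ D := fun hD =>
        hy' (Finset.mem_sdiff.mpr ⟨hD, (Finset.mem_sdiff.mp hy).2⟩)
      rw [hθ y hyD, Real.cos_zero]
    rw [this]

theorem randomSubset_map (g : Equiv.Perm X) (D : Finset X) (θ : X → ℝ) (A : Set (Finset X)) :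
    randomSubset D θ (g.finsetCongr ⁻¹' A)
      = randomSubset (g.finsetCongr D) (fun y => θ (g.symm y)) A := by
  classical
  unfold randomSubset
  refine Finset.sum_equiv g.finsetCongr (fun B => ?_) fun B _ => ?_
  · simp [Finset.map_subset_map]
  · have : subsetAmplitude (g.finsetCongr D) (fun y => θ (g.symm y)) (g.finsetCongr B)
        = subsetAmplitude D θ B := by
      simp [subsetAmplitude, ← Finset.map_sdiff]
    rw [this, mem_preimage]

theorem one_sub_le_prod_cos (D : Finset X) (u : X → ℝ) :
    1 - (∑ y ∈ D, u y ^ 2) / 2 ≤ ∏ y ∈ D, Real.cos (u y) := by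
  classical
  induction D using Finset.induction_on with
  | empty => simp
  | insert y D hy ih =>
    rw [Finset.sum_insert hy, Finset.prod_insert hy]
    have h1 : ∏ y ∈ D, Real.cos (u y) ≤ 1 := by
      refine (le_abs_self _).trans ?_
      rw [Finset.abs_prod]
      exact Finset.prod_le_one (fun _ _ => abs_nonneg _) fun _ _ => Real.abs_cos_le_one _
    have h2 := Real.one_sub_sq_div_two_le_cos (x := u y)
    nlinarith [Real.cos_le_one (u y)]

/-- The total variation distance of two random subsets is bounded by their Hellinger distance,
which is easily computed. -/
theorem sq_randomSubset_sub_le (D : Finset X) (θ η : X → ℝ) (A : Set (Finset X)) :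
    (randomSubset D θ A - randomSubset D η A) ^ 2 ≤ 4 * ∑ y ∈ D, (θ y - η y) ^ 2 := by
  classical
  set c := ∏ y ∈ D, Real.cos (θ y - η y) with hc
  have hθ := sum_subsetAmplitude_mul D θ θ
  have hη := sum_subsetAmplitude_mul D η η
  have hθη := sum_subsetAmplitude_mul D θ η
  simp only [sub_self, Real.cos_zero, Finset.prod_const_one] at hθ hη
  have h1 : ∑ B ∈ D.powerset, (subsetAmplitude D θ B - subsetAmplitude D η B) ^ 2 = 2 - 2 * c := by
    have : ∀ B, (subsetAmplitude D θ B - subsetAmplitude D η B) ^ 2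
        = subsetAmplitude D θ B * subsetAmplitude D θ B
          + subsetAmplitude D η B * subsetAmplitude D η B
          - 2 * (subsetAmplitude D θ B * subsetAmplitude D η B) := fun B => by ring
    simp only [this, Finset.sum_add_distrib, Finset.sum_sub_distrib, ← Finset.mul_sum, hθ, hη, hθη]
    ring
  have h2 : ∑ B ∈ D.powerset, (subsetAmplitude D θ B + subsetAmplitude D η B) ^ 2 = 2 + 2 * c := by
    have : ∀ B, (subsetAmplitude D θ B + subsetAmplitude D η B) ^ 2
        = subsetAmplitude D θ B * subsetAmplitude D θ B
          + subsetAmplitude D η B * subsetAmplitude D η B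
          + 2 * (subsetAmplitude D θ B * subsetAmplitude D η B) := fun B => by ring
    simp only [this, Finset.sum_add_distrib, ← Finset.mul_sum, hθ, hη, hθη]
    ring
  have h3 : |randomSubset D θ A - randomSubset D η A| ≤ ∑ B ∈ D.powerset,
      |subsetAmplitude D θ B - subsetAmplitude D η B|
        * |subsetAmplitude D θ B + subsetAmplitude D η B| := by
    unfold randomSubset
    rw [← Finset.sum_sub_distrib]
    refine (Finset.abs_sum_le_sum_abs _ _).trans (Finset.sum_le_sum fun B _ => ?_)
    split_ifs
    · rw [← abs_mul]
      exact le_of_eq (congrArg _ (by ring))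
    · rw [sub_zero, abs_zero]
      positivity
  have h4 := Finset.sum_mul_sq_le_sq_mul_sq D.powerset
    (fun B => |subsetAmplitude D θ B - subsetAmplitude D η B|)
    (fun B => |subsetAmplitude D θ B + subsetAmplitude D η B|)
  simp only [sq_abs, h1, h2] at h4
  have h5 : 0 ≤ 2 - 2 * c := h1 ▸ Finset.sum_nonneg fun _ _ => sq_nonneg _
  have h6 := one_sub_le_prod_cos D fun y => θ y - η y
  rw [← hc] at h6
  have h7 : (randomSubset D θ A - randomSubset D η A) ^ 2 ≤ (2 - 2 * c) * (2 + 2 * c) := by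
    rw [← sq_abs]
    exact (pow_le_pow_left₀ (abs_nonneg _) h3 2).trans h4
  nlinarith

end RandomSubset

/-! ### Dirichlet energy and invariant means on finite subsets -/

section Energy

variable {X : Type*}

/-- The part of the Dirichlet energy of `a` carried by the edges from `y` to `g y`. -/
noncomputable def dirichletEnergy (g : Equiv.Perm X) (a : X → ℝ) : ℝ :=
  ∑' y, (a (g y) - a y) ^ 2

theorem summable_energy (g h : Equiv.Perm X) {a : X → ℝ} (ha : a.HasFiniteSupport) :
    Summable fun y => (a (g y) - a (h y)) ^ 2 := by
  have hg := ha.fun_comp_of_injective g.injective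
  have hh := ha.fun_comp_of_injective h.injective
  refine summable_of_hasFiniteSupport ((hg.union hh).subset fun y hy => ?_)
  by_contra h'
  simp only [mem_union, Function.mem_support, not_or, not_not] at h'
  simp [h'] at hy

theorem summable_dirichletEnergy (g : Equiv.Perm X) {a : X → ℝ} (ha : a.HasFiniteSupport) :
    Summable fun y => (a (g y) - a y) ^ 2 :=
  summable_energy g 1 ha

theorem dirichletEnergy_nonneg (g : Equiv.Perm X) (a : X → ℝ) : 0 ≤ dirichletEnergy g a :=
  tsum_nonneg fun _ => sq_nonneg _

theorem dirichletEnergy_one (a : X → ℝ) : dirichletEnergy 1 a = 0 := by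
  simp [dirichletEnergy]

theorem dirichletEnergy_inv (g : Equiv.Perm X) (a : X → ℝ) :
    dirichletEnergy g⁻¹ a = dirichletEnergy g a := by
  unfold dirichletEnergy
  rw [← g.tsum_eq]
  refine tsum_congr fun y => ?_
  rw [← Equiv.Perm.mul_apply, inv_mul_cancel, Equiv.Perm.one_apply]
  ring

theorem dirichletEnergy_mul_le (g h : Equiv.Perm X) {a : X → ℝ} (ha : a.HasFiniteSupport) :
    dirichletEnergy (g * h) a ≤ 2 * dirichletEnergy g a + 2 * dirichletEnergy h a := by
  have h1 : dirichletEnergy g a = ∑' y, (a ((g * h) y) - a (h y)) ^ 2 :=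
    (h.tsum_eq fun y => (a (g y) - a y) ^ 2).symm
  rw [h1]
  unfold dirichletEnergy
  rw [← tsum_mul_left, ← tsum_mul_left, ← Summable.tsum_add]
  · refine Summable.tsum_le_tsum (fun y => ?_) (summable_dirichletEnergy (g * h) ha) ?_
    · nlinarith [sq_nonneg (a ((g * h) y) - a (h y) - (a (h y) - a y))]
    · exact ((summable_energy (g * h) h ha).mul_left 2).add
        ((summable_dirichletEnergy h ha).mul_left 2)
  · exact (summable_energy (g * h) h ha).mul_left 2
  · exact (summable_dirichletEnergy h ha).mul_left 2

theorem sq_min_max_sub_le (a b c d : ℝ) :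
    (min 1 (max a b) - min 1 (max c d)) ^ 2 ≤ (a - c) ^ 2 + (b - d) ^ 2 := by
  have h0 := abs_min_sub_min_le_max 1 (max a b) 1 (max c d)
  rw [sub_self, abs_zero, max_eq_right (abs_nonneg (max a b - max c d))] at h0
  have h1 := pow_le_pow_left₀ (abs_nonneg _) (h0.trans (abs_max_sub_max_le_max a b c d)) 2
  rw [sq_abs] at h1
  rw [← sq_abs (a - c), ← sq_abs (b - d)]
  rcases max_choice |a - c| |b - d| with h2 | h2 <;> rw [h2] at h1 <;>
    nlinarith [sq_nonneg |a - c|, sq_nonneg |b - d|]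

theorem dirichletEnergy_min_max_le (g : Equiv.Perm X) {a b : X → ℝ} (ha : a.HasFiniteSupport)
    (hb : b.HasFiniteSupport) (hab : (fun y => min 1 (max (a y) (b y))).HasFiniteSupport) :
    dirichletEnergy g (fun y => min 1 (max (a y) (b y)))
      ≤ dirichletEnergy g a + dirichletEnergy g b := by
  have h := summable_dirichletEnergy g hab
  unfold dirichletEnergy
  rw [← Summable.tsum_add (summable_dirichletEnergy g ha) (summable_dirichletEnergy g hb)]
  exact Summable.tsum_le_tsum (fun y => sq_min_max_sub_le (a (g y)) (b (g y)) (a y) (b y)) h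
    ((summable_dirichletEnergy g ha).add (summable_dirichletEnergy g hb))

/-- A permutation that is piecewise equal to finitely many others costs no more energy than these
do together. -/
theorem dirichletEnergy_le_sum {f : Equiv.Perm X} {T : Finset (Equiv.Perm X)}
    (hf : ∀ y, ∃ g ∈ T, f y = g y) {a : X → ℝ} (ha : a.HasFiniteSupport) :
    dirichletEnergy f a ≤ ∑ g ∈ T, dirichletEnergy g a := by
  unfold dirichletEnergy
  rw [← Summable.tsum_finsetSum fun g _ => summable_dirichletEnergy g ha]
  refine Summable.tsum_le_tsum (fun y => ?_) (summable_dirichletEnergy f ha)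
    (summable_sum fun g _ => summable_dirichletEnergy g ha)
  obtain ⟨g, hg, hy⟩ := hf y
  rw [hy]
  exact Finset.single_le_sum (f := fun g : Equiv.Perm X => (a (g y) - a y) ^ 2)
    (fun _ _ => sq_nonneg _) hg

/-- `E` has vanishing capacity for the permutations in `Γ`: there are finitely supported functions
that are `1` on `E` and whose Dirichlet energy tends to `0`. -/
def HasZeroCapacity (Γ : Set (Equiv.Perm X)) (E : Set X) : Prop :=
  ∃ a : ℕ → X → ℝ, (∀ n, (a n).HasFiniteSupport) ∧ (∀ n, ∀ y ∈ E, a n y = 1) ∧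
    ∀ g ∈ Γ, Tendsto (fun n => dirichletEnergy g (a n)) atTop (𝓝 0)

theorem HasZeroCapacity.finset {Γ : Set (Equiv.Perm X)} (E : Finset X)
    (h : ∀ x ∈ E, HasZeroCapacity Γ {x}) : HasZeroCapacity Γ (E : Set X) := by
  classical
  induction E using Finset.induction_on with
  | empty => exact ⟨fun _ _ => 0, fun _ => Function.hasFiniteSupport_fun_zero, by simp,
      by simp [dirichletEnergy]⟩
  | insert x E _ ih =>
    obtain ⟨a, ha, ha1, hat⟩ := ih fun y hy => h y (Finset.mem_insert_of_mem hy)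
    obtain ⟨b, hb, hb1, hbt⟩ := h x (Finset.mem_insert_self x E)
    have hfin : ∀ n, (fun y => min 1 (max (a n y) (b n y))).HasFiniteSupport := fun n => by
      refine ((ha n).union (hb n)).subset fun y hy => ?_
      by_contra h'
      simp only [mem_union, Function.mem_support, not_or, not_not] at h'
      simp [h'] at hy
    -- Truncating at `1` ensures that the maximum is `1` on both sets.
    refine ⟨fun n y => min 1 (max (a n y) (b n y)), hfin, fun n y hy => ?_, fun g hg => ?_⟩
    · rcases Finset.mem_insert.mp (Finset.mem_coe.mp hy) with rfl | hy
      · simp [hb1 n y rfl]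
      · simp [ha1 n y hy]
    · exact squeeze_zero (fun n => dirichletEnergy_nonneg _ _)
        (fun n => dirichletEnergy_min_max_le g (ha n) (hb n) (hfin n))
        (by simpa using (hat g hg).add (hbt g hg))

theorem HasZeroCapacity.closure {Γ : Set (Equiv.Perm X)} {E : Set X} (h : HasZeroCapacity Γ E) :
    HasZeroCapacity (Subgroup.closure Γ : Set (Equiv.Perm X)) E := by
  obtain ⟨a, ha, ha1, hat⟩ := h
  refine ⟨a, ha, ha1, fun g hg => ?_⟩
  induction hg using Subgroup.closure_induction with
  | mem g hg => exact hat g hg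
  | one => simp [dirichletEnergy_one]
  | mul g h _ _ hg hh =>
    refine squeeze_zero (fun n => dirichletEnergy_nonneg _ _)
      (fun n => dirichletEnergy_mul_le g h (ha n)) ?_
    simpa using (hg.const_mul 2).add (hh.const_mul 2)
  | inv g _ hg => simpa only [dirichletEnergy_inv] using hg

theorem HasZeroCapacity.piecewise {Γ Δ : Set (Equiv.Perm X)} {E : Set X}
    (h : HasZeroCapacity Γ E)
    (hΔ : ∀ f ∈ Δ, ∃ T : Finset (Equiv.Perm X), (T : Set (Equiv.Perm X)) ⊆ Γ ∧
      ∀ y, ∃ g ∈ T, f y = g y) :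
    HasZeroCapacity Δ E := by
  obtain ⟨a, ha, ha1, hat⟩ := h
  refine ⟨a, ha, ha1, fun f hf => ?_⟩
  obtain ⟨T, hT, hfT⟩ := hΔ f hf
  refine squeeze_zero (fun n => dirichletEnergy_nonneg _ _)
    (fun n => dirichletEnergy_le_sum hfT (ha n)) ?_
  simpa using tendsto_finsetSum T fun g hg => hat g (hT hg)

/-- The distribution of a random subset with slowly varying densities is almost invariant. -/
theorem sq_randomSubset_preimage_sub_le (g : Equiv.Perm X) {D : Finset X} {θ : X → ℝ}
    (hθ : ∀ y, y ∉ D → θ y = 0) (A : Set (Finset X)) :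
    (randomSubset D θ (g.finsetCongr ⁻¹' A) - randomSubset D θ A) ^ 2
      ≤ 4 * dirichletEnergy g θ := by
  classical
  have hθg : ∀ y, y ∉ g.finsetCongr D → θ (g.symm y) = 0 := fun y hy => hθ _ fun h => hy <|
    Finset.mem_map.mpr ⟨_, h, g.apply_symm_apply y⟩
  rw [randomSubset_map,
    ← randomSubset_eq_of_subset (Finset.subset_union_left (s₂ := g.finsetCongr D)) hθ,
    ← randomSubset_eq_of_subset (Finset.subset_union_right (s₁ := D)) hθg]
  refine (sq_randomSubset_sub_le _ _ _ A).trans ?_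
  rw [← dirichletEnergy_inv]
  have hfin : θ.HasFiniteSupport := D.finite_toSet.subset fun y hy => by
    by_contra h
    exact hy (hθ y h)
  have := (summable_dirichletEnergy g⁻¹ hfin).sum_le_tsum (D ∪ g.finsetCongr D)
    fun _ _ => sq_nonneg _
  exact mul_le_mul_of_nonneg_left this (by norm_num)

/-- If `E` has vanishing capacity, then there is an invariant mean on the finite subsets that is
concentrated on those that contain `E`. -/
theorem HasZeroCapacity.exists_mean {Γ : Set (Equiv.Perm X)} {E : Set X}
    (h : HasZeroCapacity Γ E) :
    ∃ m : Set (Finset X) → ℝ, IsMean m ∧ (∀ g ∈ Γ, ∀ A, m (g.finsetCongr ⁻¹' A) = m A) ∧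
      m {B | E ⊆ B} = 1 := by
  classical
  obtain ⟨a, ha, ha1, hat⟩ := h
  -- With `θ = π / 2`, the points of `E` are chosen with probability `1`.
  let θ : ℕ → X → ℝ := fun n y => Real.pi / 2 * a n y
  let D : ℕ → Finset X := fun n => (ha n).toFinset
  have hθ : ∀ n y, y ∉ D n → θ n y = 0 := fun n y hy => by
    have : a n y = 0 := by
      by_contra h
      exact hy ((ha n).mem_toFinset.mpr h)
    simp [θ, this]
  have hθe : ∀ n g, dirichletEnergy g (θ n) = (Real.pi / 2) ^ 2 * dirichletEnergy g (a n) :=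
    fun n g => by
      unfold dirichletEnergy
      rw [← tsum_mul_left]
      exact tsum_congr fun y => by simp only [θ]; ring
  let U : Ultrafilter ℕ := Ultrafilter.of atTop
  have hU : (U : Filter ℕ) ≤ atTop := Ultrafilter.of_le _
  obtain ⟨m, hm, hlim⟩ := exists_isMean_tendsto U fun n => isMean_randomSubset (D n) (θ n)
  refine ⟨m, hm, fun g hg A => ?_, ?_⟩
  · have h1 : Tendsto (fun n => (randomSubset (D n) (θ n) (g.finsetCongr ⁻¹' A)
        - randomSubset (D n) (θ n) A) ^ 2) U (𝓝 0) := by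
      refine squeeze_zero (fun n => sq_nonneg _)
        (fun n => sq_randomSubset_preimage_sub_le g (hθ n) A) ?_
      simp only [hθe]
      simpa using (((hat g hg).const_mul ((Real.pi / 2) ^ 2)).const_mul 4).mono_left hU
    have h2 := tendsto_nhds_unique h1 (((hlim _).sub (hlim A)).pow 2)
    exact sub_eq_zero.mp (pow_eq_zero_iff two_ne_zero |>.mp h2.symm)
  · refine tendsto_nhds_unique (hlim _) (tendsto_const_nhds.congr fun n => ?_)
    rw [← (isMean_randomSubset (D n) (θ n)).2.1]
    unfold randomSubset
    refine Finset.sum_congr rfl fun B hB => ?_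
    by_cases hE : E ⊆ B
    · simp [hE]
    · obtain ⟨y, hy, hyB⟩ := Set.not_subset.mp hE
      have hθy : θ n y = Real.pi / 2 := by simp [θ, ha1 n y hy]
      have hyD : y ∈ D n := by
        by_contra h
        have := hθ n y h
        rw [hθy] at this
        exact Real.pi_ne_zero (by linarith)
      have : subsetAmplitude (D n) (θ n) B = 0 := by
        rw [subsetAmplitude, Finset.prod_eq_zero (i := y) (s := D n \ B)
          (Finset.mem_sdiff.mpr ⟨hyD, hyB⟩) (by rw [hθy, Real.cos_pi_div_two]), mul_zero]
      simp [this]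

/-- If all points of `S` have vanishing capacity, then there is an invariant mean on the
finite subsets that gives full weight to the sets containing any given finite subset of `S`. -/
theorem exists_mean_of_hasZeroCapacity {Γ : Set (Equiv.Perm X)} {S : Set X}
    (h : ∀ x ∈ S, HasZeroCapacity Γ {x}) :
    ∃ m : Set (Finset X) → ℝ, IsMean m ∧ (∀ g ∈ Γ, ∀ A, m (g.finsetCongr ⁻¹' A) = m A) ∧
      ∀ E ⊆ S, E.Finite → m {B | E ⊆ B} = 1 := by
  classical
  have h' : ∀ E : Finset S, ∃ m : Set (Finset X) → ℝ, IsMean m ∧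
      (∀ g ∈ Γ, ∀ A, m (g.finsetCongr ⁻¹' A) = m A) ∧ m {B | ∀ x ∈ E, (x : X) ∈ B} = 1 :=
    fun E => by
      obtain ⟨m, hm, hinv, h1⟩ := (HasZeroCapacity.finset (Γ := Γ) (E.image ((↑) : S → X))
        fun x hx => by
          obtain ⟨y, _, rfl⟩ := Finset.mem_image.mp hx
          exact h y y.2).exists_mean
      refine ⟨m, hm, hinv, hm.eq_one_of_superset ?_ h1⟩
      intro B hB x hx
      refine hB ?_
      exact Finset.mem_coe.mpr (Finset.mem_image_of_mem _ hx)
  choose ν hν hinv h1 using h'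
  let U : Ultrafilter (Finset S) := Ultrafilter.of atTop
  have hU : (U : Filter (Finset S)) ≤ atTop := Ultrafilter.of_le _
  obtain ⟨m, hm, hlim⟩ := exists_isMean_tendsto U hν
  refine ⟨m, hm, fun g hg A => ?_, fun E hE hfin => ?_⟩
  · refine tendsto_nhds_unique (hlim _) ?_
    simp only [hinv _ g hg A]
    exact hlim A
  · refine tendsto_nhds_unique (hlim _) (tendsto_const_nhds.congr' ?_)
    have hE' : (((↑) : S → X) ⁻¹' E).Finite := hfin.preimage Subtype.val_injective.injOn
    filter_upwards [hU (eventually_ge_atTop hE'.toFinset)] with F hF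
    refine ((hν F).eq_one_of_superset ?_ (h1 F)).symm
    intro B hB x hx
    exact hB ⟨x, hE hx⟩ (hF (by simpa using hx))

end Energy

/-! ### Recurrence -/

section Recurrence

variable {X ι : Type*} [Fintype ι]

open Classical in
/-- For the random walk that applies one of the permutations `σ i`, chosen uniformly at random,
`hitProb σ x n y` is the probability that the walk started at `y` visits `x` at time `n + 1` and
not at the times `1, …, n`. -/
noncomputable def hitProb (σ : ι → Equiv.Perm X) (x : X) : ℕ → X → ℝ
  | 0, y => (∑ i, if σ i y = x then 1 else 0) / Fintype.card ι
  | n + 1, y => (∑ i, if σ i y = x then 0 else hitProb σ x n (σ i y)) / Fintype.card ι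

open Classical in
/-- The probability that the random walk started at `y` visits `x` at one of the times
`0, …, n`. -/
noncomputable def hitBefore (σ : ι → Equiv.Perm X) (x : X) (n : ℕ) (y : X) : ℝ :=
  if y = x then 1 else ∑ k ∈ Finset.range n, hitProb σ x k y

variable (σ : ι → Equiv.Perm X) (x : X)

theorem hitProb_nonneg (n : ℕ) (y : X) : 0 ≤ hitProb σ x n y := by
  induction n generalizing y with
  | zero => exact div_nonneg (Finset.sum_nonneg fun i _ => by split_ifs <;> simp) (by positivity)
  | succ n ih =>
    refine div_nonneg (Finset.sum_nonneg fun i _ => ?_) (by positivity)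
    split_ifs
    · exact le_rfl
    · exact ih _

theorem hitBefore_nonneg (n : ℕ) (y : X) : 0 ≤ hitBefore σ x n y := by
  unfold hitBefore
  split_ifs
  · exact zero_le_one
  · exact Finset.sum_nonneg fun k _ => hitProb_nonneg σ x k y

theorem hasFiniteSupport_hitProb (n : ℕ) : (hitProb σ x n).HasFiniteSupport := by
  induction n with
  | zero =>
    refine (finite_iUnion fun i => (finite_singleton x).preimage (σ i).injective.injOn).subset
      fun y hy => ?_
    by_contra h
    simp only [mem_iUnion, mem_preimage, mem_singleton_iff, not_exists] at h
    simp [hitProb, h] at hy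
  | succ n ih =>
    refine (finite_iUnion fun i => Set.Finite.preimage (σ i).injective.injOn ih).subset
      fun y hy => ?_
    by_contra h
    simp only [mem_iUnion, mem_preimage, Function.mem_support, not_exists, not_not] at h
    simp [hitProb, h] at hy

theorem hasFiniteSupport_hitBefore (n : ℕ) : (hitBefore σ x n).HasFiniteSupport := by
  refine ((finite_singleton x).union ((Finset.range n).finite_toSet.biUnion fun k _ =>
    hasFiniteSupport_hitProb σ x k)).subset fun y hy => ?_
  by_contra h
  simp only [mem_union, mem_singleton_iff, mem_iUnion, Finset.mem_coe, Function.mem_support,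
    not_or, not_exists, not_not] at h
  refine hy ?_
  rw [hitBefore, if_neg h.1]
  exact Finset.sum_eq_zero h.2

/-- Conditioning on the first step. -/
theorem sum_hitBefore (n : ℕ) (y : X) :
    (∑ i, hitBefore σ x n (σ i y)) / Fintype.card ι
      = ∑ k ∈ Finset.range (n + 1), hitProb σ x k y := by
  classical
  rw [Finset.sum_range_succ']
  simp only [hitProb]
  rw [← Finset.sum_div, Finset.sum_comm, ← add_div, ← Finset.sum_add_distrib]
  congr 1
  refine Finset.sum_congr rfl fun i _ => ?_
  unfold hitBefore
  split_ifs <;> simp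

/-- The Dirichlet energy of `hitBefore` is controlled by the escape probability, because
`hitBefore` is subharmonic outside `x`. -/
theorem sum_dirichletEnergy_hitBefore_le [Nonempty ι] (n : ℕ) :
    ∑ i, dirichletEnergy (σ i) (hitBefore σ x n)
      ≤ 2 * Fintype.card ι * (1 - ∑ k ∈ Finset.range (n + 1), hitProb σ x k x) := by
  classical
  set h := hitBefore σ x n with hh
  have hd : (0 : ℝ) < Fintype.card ι := by exact_mod_cast Fintype.card_pos
  have hfin : h.HasFiniteSupport := hasFiniteSupport_hitBefore σ x n
  have s1 : Summable fun y => h y ^ 2 := summable_of_hasFiniteSupport <|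
    hfin.subset fun y hy => by
      by_contra h'
      simp only [Function.mem_support, not_not] at h'
      simp [h'] at hy
  have s2 : ∀ i, Summable fun y => h (σ i y) ^ 2 := fun i =>
    (σ i).summable_iff.mpr s1
  have s3 : ∀ i, Summable fun y => h y * h (σ i y) := fun i => summable_of_hasFiniteSupport <|
    hfin.subset fun y hy => by
      by_contra h'
      simp only [Function.mem_support, not_not] at h'
      simp [h'] at hy
  have e1 : ∀ i, dirichletEnergy (σ i) h = ∑' y, 2 * (h y ^ 2 - h y * h (σ i y)) := fun i => by
    have : ∑' y, h (σ i y) ^ 2 = ∑' y, h y ^ 2 := (σ i).tsum_eq fun y => h y ^ 2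
    rw [tsum_mul_left, Summable.tsum_sub s1 (s3 i)]
    have e : ∀ y, (h (σ i y) - h y) ^ 2 = h (σ i y) ^ 2 + h y ^ 2 - 2 * (h y * h (σ i y)) :=
      fun y => by ring
    unfold dirichletEnergy
    simp only [e]
    rw [Summable.tsum_sub ((s2 i).add s1) ((s3 i).mul_left 2), Summable.tsum_add (s2 i) s1, this,
      tsum_mul_left]
    ring
  simp only [e1]
  rw [← Summable.tsum_finsetSum fun i _ => (s1.sub (s3 i)).mul_left 2]
  have e2 : ∀ y, ∑ i, 2 * (h y ^ 2 - h y * h (σ i y))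
      = 2 * Fintype.card ι * (h y * (h y - ∑ k ∈ Finset.range (n + 1), hitProb σ x k y)) :=
    fun y => by
      rw [← sum_hitBefore, ← hh, ← Finset.mul_sum, Finset.sum_sub_distrib, ← Finset.mul_sum]
      simp only [Finset.sum_const, Finset.card_univ, nsmul_eq_mul]
      field_simp
  simp only [e2]
  rw [tsum_mul_left]
  refine mul_le_mul_of_nonneg_left ?_ (by positivity)
  have hx : h x = 1 := by simp [hh, hitBefore]
  rw [← tsum_ite_eq (α := ℝ) x fun _ => 1 - ∑ k ∈ Finset.range (n + 1), hitProb σ x k x]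
  refine Summable.tsum_le_tsum (fun y => ?_) ?_ ?_
  · split_ifs with hy
    · rw [hy, hx, one_mul]
    · refine mul_nonpos_of_nonneg_of_nonpos (hitBefore_nonneg σ x n y) ?_
      rw [hh, hitBefore, if_neg hy, Finset.sum_range_succ]
      linarith [hitProb_nonneg σ x n y]
  · refine summable_of_hasFiniteSupport (hfin.subset fun y hy => ?_)
    by_contra h'
    simp only [Function.mem_support, not_not] at h'
    simp [h'] at hy
  · refine summable_of_hasFiniteSupport ((finite_singleton x).subset fun y hy => ?_)
    by_contra h'
    simp only [mem_singleton_iff] at h'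
    simp [h'] at hy

/-- A recurrent point has vanishing capacity. -/
theorem hasZeroCapacity_of_hasSum (h : HasSum (fun n => hitProb σ x n x) 1) :
    HasZeroCapacity (range σ) {x} := by
  refine ⟨hitBefore σ x, hasFiniteSupport_hitBefore σ x, ?_, ?_⟩
  · rintro n _ rfl
    simp [hitBefore]
  · rintro _ ⟨i, rfl⟩
    have : Nonempty ι := ⟨i⟩
    refine squeeze_zero (fun n => dirichletEnergy_nonneg _ _) (fun n =>
      (Finset.single_le_sum (f := fun j => dirichletEnergy (σ j) (hitBefore σ x n))
        (fun j _ => dirichletEnergy_nonneg _ _) (Finset.mem_univ i)).trans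
        (sum_dirichletEnergy_hitBefore_le σ x n)) ?_
    have h1 := h.tendsto_sum_nat.comp (tendsto_add_atTop_nat 1)
    simpa using (h1.const_sub 1).const_mul (2 * (Fintype.card ι : ℝ))

end Recurrence

section Schreier

variable {M V S : Type*} [Group M] [MulAction M V] [Fintype S] (ι : S → M)

open Classical in
theorem simpleRandomWalk_schreierGraph (v w : Quiver.SchreierGraph V ι) :
    simpleRandomWalk (Quiver.SchreierGraph V ι) v w
      = (∑ s, if ι s • v = w then (1 : ℝ) else 0) / Fintype.card S := by
  unfold simpleRandomWalk
  congr 1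
  · change (Nat.card {s : S // ι s • v = w} : ℝ) = _
    rw [Nat.card_eq_fintype_card, Fintype.card_subtype]
    simp
  · let e : S ≃ Quiver.Star v :=
      { toFun := fun s => ⟨ι s • v, s, rfl⟩
        invFun := fun p => p.2.1
        left_inv := fun _ => rfl
        right_inv := fun ⟨_, _, rfl⟩ => rfl }
    rw [← Nat.card_congr e, Nat.card_eq_fintype_card]

theorem hasSum_simpleRandomWalk_mul (v : Quiver.SchreierGraph V ι)
    (f : Quiver.SchreierGraph V ι → ℝ) :
    HasSum (fun w => simpleRandomWalk (Quiver.SchreierGraph V ι) v w * f w)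
      ((∑ s, f (ι s • v)) / Fintype.card S) := by
  classical
  simp only [simpleRandomWalk_schreierGraph, div_mul_eq_mul_div, Finset.sum_mul]
  refine HasSum.div_const (hasSum_sum fun s _ => ?_) _
  have := hasSum_single (ι s • v) (f := fun w => (if ι s • v = w then (1 : ℝ) else 0) * f w)
    fun w hw => by simp [Ne.symm hw]
  simpa only [if_true, one_mul] using this

open Classical in
theorem firstHit_schreierGraph_succ (o v : Quiver.SchreierGraph V ι) (n : ℕ) :
    firstHit (simpleRandomWalk (Quiver.SchreierGraph V ι)) o (n + 1) v
      = (∑ s, if ι s • v = o then 0 else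
          firstHit (simpleRandomWalk (Quiver.SchreierGraph V ι)) o n (ι s • v))
        / Fintype.card S := by
  rw [firstHit, ← (hasSum_simpleRandomWalk_mul ι v fun w => if w = o then 0 else
    firstHit (simpleRandomWalk (Quiver.SchreierGraph V ι)) o n w).tsum_eq]
  refine (tsum_subtype {w | w ≠ o} fun w => simpleRandomWalk (Quiver.SchreierGraph V ι) v w *
    firstHit (simpleRandomWalk (Quiver.SchreierGraph V ι)) o n w).trans (tsum_congr fun w => ?_)
  by_cases hw : w = o <;> simp [hw]

/-- First return probabilities on the orbital Schreier graph can be computed in the whole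
space. -/
theorem firstHit_orbitalSchreierGraph {G Y : Type*} [Group G] [MulAction G Y] (x : Y)
    (T : Finset G) (n : ℕ) (v : OrbitalSchreierGraph G x T) :
    firstHit (simpleRandomWalk (OrbitalSchreierGraph G x T))
        (.ofVertex ⟨x, MulAction.mem_orbit_self x⟩) n v
      = hitProb (fun t : T => MulAction.toPerm (t : G)) x n v.toVertex := by
  classical
  have key : ∀ (t : T) (v : OrbitalSchreierGraph G x T),
      (t : G) • v = .ofVertex ⟨x, MulAction.mem_orbit_self x⟩ ↔
        (t : G) • (v.toVertex : Y) = x := fun t v => by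
    rw [Quiver.SchreierGraph.ext_iff, Subtype.ext_iff]
    exact Iff.rfl
  induction n generalizing v with
  | zero => simp only [firstHit, simpleRandomWalk_schreierGraph, hitProb, key,
      MulAction.toPerm_apply]
  | succ n ih =>
    rw [firstHit_schreierGraph_succ]
    simp only [hitProb, key, MulAction.toPerm_apply, ih]
    rfl

theorem IsRecurrentOrbitalSchreierGraph.hasZeroCapacity {G Y : Type*} [Group G] [MulAction G Y]
    {x : Y} (h : IsRecurrentOrbitalSchreierGraph G x) :
    HasZeroCapacity (range (MulAction.toPerm : G → Equiv.Perm Y)) {x} := by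
  obtain ⟨T, _, hT, hrec⟩ := h
  unfold IsRecurrentState at hrec
  simp only [firstHit_orbitalSchreierGraph] at hrec
  obtain ⟨a, ha, ha1, hat⟩ := (hasZeroCapacity_of_hasSum _ _ hrec).closure
  refine ⟨a, ha, ha1, ?_⟩
  rintro _ ⟨g, rfl⟩
  refine hat _ ?_
  have hg : g ∈ Subgroup.closure (T : Set G) := hT ▸ Subgroup.mem_top g
  have := Subgroup.mem_map_of_mem (MulAction.toPermHom G Y) hg
  rw [MonoidHom.map_closure] at this
  refine Subgroup.closure_mono ?_ this
  rintro _ ⟨t, ht, rfl⟩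
  exact ⟨⟨t, ht⟩, rfl⟩

end Schreier

/-! ### Germs and singular points -/

section GermMem

variable {X : Type*} [TopologicalSpace X] {H : Subgroupoid (GermBase X)}

theorem germMem_iff {g : X ≃ₜ X} {x y : X} (h : g x = y) :
    GermMem H g x ↔ homeoGerm g h ∈ H.arrows x y := by
  subst h
  rfl

theorem GermMem.congr {g g' : X ≃ₜ X} {x : X} (hg : GermMem H g x) (h : g =ᶠ[𝓝 x] g') :
    GermMem H g' x := by
  rw [germMem_iff h.eq_of_nhds.symm]
  have : homeoGerm g' h.eq_of_nhds.symm = homeoGerm g (rfl : g x = g x) :=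
    Quotient.sound h.symm
  rw [this]
  exact hg

theorem germMem_one (hH : H.IsWide) (x : X) : GermMem H 1 x :=
  hH.wide x

theorem GermMem.mul {g h : X ≃ₜ X} {x : X} (hg : GermMem H g (h x)) (hh : GermMem H h x) :
    GermMem H (g * h) x := by
  have e : homeoGerm (g * h) rfl =
      HomeoGerm.comp (homeoGerm h (x := x) rfl) (homeoGerm g (x := h x) rfl) :=
    Quotient.sound (EventuallyEq.refl _ _)
  exact (congrArg (· ∈ H.arrows x (g (h x))) e).mpr (H.mul hh hg)

theorem GermMem.inv {g : X ≃ₜ X} {x : X} (hg : GermMem H g x) : GermMem H g⁻¹ (g x) := by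
  rw [germMem_iff (show g⁻¹ (g x) = x from g.symm_apply_apply x)]
  exact H.inv hg

theorem germMem_germGroupoid_iff {G : Subgroup (X ≃ₜ X)} {f : X ≃ₜ X} {x : X} :
    GermMem (germGroupoid G) f x ↔ ∃ g ∈ G, f =ᶠ[𝓝 x] g := by
  constructor
  · rintro ⟨g, hg, h, e⟩
    exact ⟨g, hg, (show g =ᶠ[𝓝 x] f from Quotient.exact e).symm⟩
  · rintro ⟨g, hg, h⟩
    exact GermMem.congr ⟨g, hg, rfl, rfl⟩ h.symm

theorem finite_not_germMem_of_mem_closure (hH : H.IsWide) {S : Set (X ≃ₜ X)}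
    (hS : ∀ g ∈ S, {x : X | ¬ GermMem H g x}.Finite) {g : X ≃ₜ X}
    (hg : g ∈ Subgroup.closure S) : {x : X | ¬ GermMem H g x}.Finite := by
  induction hg using Subgroup.closure_induction with
  | mem g hg => exact hS g hg
  | one => simp [germMem_one hH]
  | mul g h _ _ hg hh =>
    refine (hh.union (hg.preimage h.injective.injOn)).subset fun x hx => ?_
    by_contra h'
    simp only [mem_union, mem_ofPred_eq, mem_preimage, not_or, not_not] at h'
    exact hx (h'.2.mul h'.1)
  | inv g _ hg =>
    refine (hg.image g).subset fun x hx => ⟨g⁻¹ x, fun h => hx ?_, g.apply_symm_apply x⟩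
    have := h.inv
    rwa [show g (g⁻¹ x) = x from g.apply_symm_apply x] at this

/-- The group of homeomorphisms that are trivial near `x`. -/
def trivialGermSubgroup (x : X) : Subgroup (X ≃ₜ X) where
  carrier := {g | g =ᶠ[𝓝 x] id}
  one_mem' := EventuallyEq.rfl
  mul_mem' {g h} hg hh := by
    have hx : h x = x := hh.eq_of_nhds
    have hc : Tendsto h (𝓝 x) (𝓝 x) := by
      simpa [ContinuousAt, hx] using h.continuous.continuousAt (x := x)
    filter_upwards [hh, hc.eventually hg] with y h1 h2
    exact h2.trans h1
  inv_mem' {g} hg := by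
    filter_upwards [hg] with y hy
    have hy' : g y = y := hy
    exact (congrArg g.symm hy').symm.trans (g.symm_apply_apply y)

theorem mem_trivialGermSubgroup {x : X} {g : X ≃ₜ X} :
    g ∈ trivialGermSubgroup x ↔ g =ᶠ[𝓝 x] id :=
  Iff.rfl

/-- The subgroup of the elements of `Γ` that preserve `B` and whose germs outside `B` belong
to `H`. -/
def singularStabilizer (hH : H.IsWide) (Γ : Subgroup (X ≃ₜ X)) (B : Set X) :
    Subgroup (X ≃ₜ X) where
  carrier := {g | g ∈ Γ ∧ (∀ x, x ∈ B ↔ g x ∈ B) ∧ ∀ x ∉ B, GermMem H g x}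
  one_mem' := ⟨Γ.one_mem, fun _ => Iff.rfl, fun x _ => germMem_one hH x⟩
  mul_mem' {g h} hg hh :=
    ⟨Γ.mul_mem hg.1 hh.1, fun x => (hh.2.1 x).trans (hg.2.1 (h x)), fun x hx =>
      (hg.2.2 _ fun h' => hx ((hh.2.1 x).mpr h')).mul (hh.2.2 x hx)⟩
  inv_mem' {g} hg := by
    have hi : ∀ x, g (g⁻¹ x) = x := g.apply_symm_apply
    have hB : ∀ x, x ∈ B ↔ g⁻¹ x ∈ B := fun x => by
      rw [hg.2.1 (g⁻¹ x), hi]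
    refine ⟨Γ.inv_mem hg.1, hB, fun x hx => ?_⟩
    have := (hg.2.2 (g⁻¹ x) fun h => hx ((hB x).mpr h)).inv
    rwa [hi] at this

/-! ### Amenability of the stabilizers -/

/-- Passing to the germs at a fixed point is an extension by a subgroup of the isotropy group. -/
theorem HasInvariantMean.of_trivialGermSubgroup {G K : Subgroup (X ≃ₜ X)} {x : X}
    (hiso : IsAmenableGroup (isotropyGroup (germGroupoid G) (germGroupoid_isWide G) x))
    (hfix : ∀ g ∈ K, g x = x) (hgerm : ∀ g ∈ K, GermMem (germGroupoid G) g x)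
    (h : HasInvariantMean ((K ⊓ trivialGermSubgroup x : Subgroup (X ≃ₜ X)) : Set (X ≃ₜ X))) :
    HasInvariantMean (K : Set (X ≃ₜ X)) := by
  -- The composition in the vertex group is in the order of arrows, so germs of inverses are used.
  have hfix' : ∀ g : K, (g : X ≃ₜ X)⁻¹ x = x := fun g => hfix _ (K.inv_mem g.2)
  let φ : K →* isotropyGroup (germGroupoid G) (germGroupoid_isWide G) x :=
    { toFun := fun g => ⟨homeoGerm (g : X ≃ₜ X)⁻¹ (hfix' g),
        (germMem_iff (hfix' g)).mp (hgerm _ (K.inv_mem g.2))⟩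
      map_one' := Subtype.ext (Quotient.sound (EventuallyEq.refl _ _))
      map_mul' := fun g h => Subtype.ext (Quotient.sound (EventuallyEq.refl _ _)) }
  refine HasInvariantMean.of_hom φ hiso (h.mono ?_)
  rintro _ ⟨g, hg, rfl⟩
  refine ⟨g.2, ?_⟩
  have h1 : homeoGerm (g : X ≃ₜ X)⁻¹ (hfix' g) = homeoGerm (1 : X ≃ₜ X) rfl :=
    congrArg Subtype.val hg
  have h2 : (g : X ≃ₜ X)⁻¹ ∈ trivialGermSubgroup x := Quotient.exact h1
  have h3 := (trivialGermSubgroup x).inv_mem h2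
  rwa [inv_inv] at h3

/-- If `B` is finite, then `singularStabilizer` is obtained from a subgroup of the topological full
group of `H` by finitely many extensions by subgroups of isotropy groups, followed by an extension
by a group of permutations of `B`. -/
theorem hasInvariantMean_singularStabilizer {G Γ : Subgroup (X ≃ₜ X)} (hH : H.IsWide)
    (hfull : IsAmenableGroup (topologicalFullGroup H hH))
    (hiso : ∀ x : X, IsAmenableGroup (isotropyGroup (germGroupoid G) (germGroupoid_isWide G) x))
    (hΓ : ∀ f ∈ Γ, ∀ x, GermMem (germGroupoid G) f x) (B : Finset X) :
    HasInvariantMean (singularStabilizer hH Γ (B : Set X) : Set (X ≃ₜ X)) := by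
  classical
  -- `L C` consists of the elements that fix `B` pointwise and are trivial near the points of `C`.
  let L : Finset X → Subgroup (X ≃ₜ X) := fun C =>
    singularStabilizer hH Γ (B : Set X) ⊓ fixingSubgroup (X ≃ₜ X) (B : Set X) ⊓
      ⨅ x ∈ C, trivialGermSubgroup x
  have hL : ∀ C g, g ∈ L C ↔ g ∈ singularStabilizer hH Γ (B : Set X) ∧
      (∀ x ∈ B, g x = x) ∧ ∀ x ∈ C, g ∈ trivialGermSubgroup x := fun C g => by
    simp only [L, Subgroup.mem_inf, Subgroup.mem_iInf, and_assoc, mem_fixingSubgroup_iff]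
    rfl
  have hbase : HasInvariantMean (L B : Set (X ≃ₜ X)) := by
    refine ((isAmenableGroup_coe_iff _).mp hfull).mono ?_
    intro g hg x
    obtain ⟨h1, -, h2⟩ := (hL B g).mp hg
    by_cases hx : x ∈ B
    · exact (germMem_one hH x).congr (mem_trivialGermSubgroup.mp (h2 x hx)).symm
    · exact h1.2.2 x hx
  have hstep : ∀ C x, x ∈ B → HasInvariantMean (L (insert x C) : Set (X ≃ₜ X)) →
      HasInvariantMean (L C : Set (X ≃ₜ X)) := fun C x hx h => by
    refine HasInvariantMean.of_trivialGermSubgroup (hiso x)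
      (fun g hg => ((hL C g).mp hg).2.1 x hx) (fun g hg => hΓ g ((hL C g).mp hg).1.1 x) (h.mono ?_)
    rintro g ⟨hg, hgx⟩
    obtain ⟨h1, h2, h3⟩ := (hL C g).mp hg
    refine (hL _ g).mpr ⟨h1, h2, fun y hy => ?_⟩
    rcases Finset.mem_insert.mp hy with rfl | hy
    · exact hgx
    · exact h3 y hy
  have hall : ∀ C ⊆ B, HasInvariantMean (L (B \ C) : Set (X ≃ₜ X)) := fun C => by
    induction C using Finset.induction_on with
    | empty => intro _; simpa using hbase
    | insert x C hx ih =>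
      intro hC
      have hxB := hC (Finset.mem_insert_self x C)
      refine hstep _ x hxB ?_
      have hins : insert x (B \ insert x C) = B \ C := by
        ext y
        by_cases hy : y = x <;> simp [hy, hx, hxB]
      rw [hins]
      exact ih fun y hy => hC (Finset.mem_insert_of_mem hy)
  have hfix : HasInvariantMean (L ∅ : Set (X ≃ₜ X)) := by
    simpa using hall B le_rfl
  let φ : singularStabilizer hH Γ (B : Set X) →* Equiv.Perm (B : Set X) :=
    { toFun := fun g => (MulAction.toPerm (g : X ≃ₜ X)).subtypePerm fun x => (g.2.2.1 x).symm
      map_one' := rfl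
      map_mul' := fun _ _ => rfl }
  refine HasInvariantMean.of_hom φ (isAmenableGroup_of_finite _) (hfix.mono ?_)
  rintro _ ⟨g, hg, rfl⟩
  refine (hL ∅ g).mpr ⟨g.2, fun x hx => ?_, by simp⟩
  exact congrArg Subtype.val (DFunLike.congr_fun hg ⟨x, hx⟩)

/-! ### The amenability theorem -/

/-- A permutation of `X` permutes the finite subsets of `X`. -/
def finsetPermHom (X : Type*) : Equiv.Perm X →* Equiv.Perm (Finset X) where
  toFun g := g.finsetCongr
  map_one' := Equiv.ext fun _ => Finset.map_refl
  map_mul' g h := Equiv.ext fun B => (Finset.map_map h.toEmbedding g.toEmbedding B).symm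

/-- A group `Γ` of homeomorphisms that are piecewise in `G`, with finitely many pieces, is amenable.
The group acts on the finite subsets of `X` with an invariant mean; for almost all finite sets `B`,
the germs of a given element outside `B` belong to `H`, and the stabilizers for the groupoid of
such arrows are amenable. -/
theorem isAmenableGroup_of_piecewise {G Γ : Subgroup (X ≃ₜ X)} (hH : H.IsWide)
    (hfull : IsAmenableGroup (topologicalFullGroup H hH))
    (hfin : ∀ g ∈ G, {x : X | ¬ GermMem H g x}.Finite)
    (hrec : ∀ x : X, IsSingularPoint G H x → IsRecurrentOrbitalSchreierGraph G x)
    (hiso : ∀ x : X, IsAmenableGroup (isotropyGroup (germGroupoid G) (germGroupoid_isWide G) x))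
    (hΓ : ∀ f ∈ Γ, ∃ T : Finset (X ≃ₜ X), (T : Set (X ≃ₜ X)) ⊆ G ∧
      ∀ x, ∃ g ∈ T, f =ᶠ[𝓝 x] g) :
    IsAmenableGroup Γ := by
  classical
  have hcap : ∀ x ∈ {x | IsSingularPoint G H x}, HasZeroCapacity
      (range fun f : Γ => (MulAction.toPerm (f : X ≃ₜ X) : Equiv.Perm X)) {x} := fun x hx => by
    refine (hrec x hx).hasZeroCapacity.piecewise ?_
    rintro _ ⟨f, rfl⟩
    obtain ⟨T, hT, hfT⟩ := hΓ f f.2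
    refine ⟨T.image MulAction.toPerm, ?_, fun y => ?_⟩
    · intro _ hσ
      obtain ⟨g, hg, rfl⟩ := Finset.mem_image.mp (Finset.mem_coe.mp hσ)
      exact ⟨⟨g, hT hg⟩, rfl⟩
    · obtain ⟨g, hg, h⟩ := hfT y
      exact ⟨_, Finset.mem_image_of_mem _ hg, h.eq_of_nhds⟩
  obtain ⟨m, hm, hinv, hweight⟩ := exists_mean_of_hasZeroCapacity hcap
  have hbad : ∀ f ∈ Γ, {x : X | ¬ GermMem H f x}.Finite ∧
      {x : X | ¬ GermMem H f x} ⊆ {x | IsSingularPoint G H x} := fun f hf => by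
    obtain ⟨T, hT, hfT⟩ := hΓ f hf
    constructor
    · refine (T.finite_toSet.biUnion fun g hg => hfin g (hT hg)).subset fun x hx => ?_
      obtain ⟨g, hg, h⟩ := hfT x
      exact mem_biUnion hg fun h' => hx (h'.congr h.symm)
    · intro x hx
      obtain ⟨g, hg, h⟩ := hfT x
      exact ⟨g, hT hg, fun h' => hx (h'.congr h.symm)⟩
  let ρ : Γ →* Equiv.Perm (Finset X) :=
    ((finsetPermHom X).comp (MulAction.toPermHom (X ≃ₜ X) X)).comp Γ.subtype
  have hρ : ∀ (g : Γ) (B : Finset X) (x : X), (g : X ≃ₜ X) x ∈ ρ g B ↔ x ∈ B := fun g B x =>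
    Finset.mem_map' (MulAction.toPerm (g : X ≃ₜ X)).toEmbedding
  rw [isAmenableGroup_coe_iff]
  refine HasInvariantMean.of_action ρ (fun g B => {x : X | ¬ GermMem H (g : X ≃ₜ X) x} ⊆ B)
    (fun B x hx => (hx (germMem_one hH x)).elim) (fun g h B hg hh x hx => ?_)
    (fun g B hg x hx => ?_) hm (fun g A => hinv _ ⟨g, rfl⟩ A)
    (fun g => hweight _ (hbad g g.2).2 (hbad g g.2).1) fun B => ?_
  · by_contra hxB
    have h1 : GermMem H (g : X ≃ₜ X) x := by
      by_contra h'
      exact hxB (hg h')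
    have h2 : GermMem H (h : X ≃ₜ X) ((g : X ≃ₜ X) x) := by
      by_contra h'
      exact hxB ((hρ g B x).mp (hh h'))
    exact hx (h2.mul h1)
  · obtain ⟨y, rfl⟩ := (g : X ≃ₜ X).surjective x
    exact (hρ g B y).mpr (hg fun h' => hx h'.inv)
  · refine (hasInvariantMean_singularStabilizer (Γ := Γ) hH hfull hiso (fun f hf x => ?_) B).mono ?_
    · obtain ⟨T, hT, hfT⟩ := hΓ f hf
      obtain ⟨g, hg, h⟩ := hfT x
      exact germMem_germGroupoid_iff.mpr ⟨g, hT hg, h⟩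
    · rintro _ ⟨g, ⟨hgB, hg⟩, rfl⟩
      refine ⟨g.2, fun x => ?_, fun x hx => ?_⟩
      · have := hρ g B x
        rw [hgB] at this
        exact this.symm
      · by_contra h'
        exact hx (hg h')

end GermMem

theorem mainTheorem1 {X : Type*} [TopologicalSpace X]
    (G : Subgroup (X ≃ₜ X)) (S : Finset (X ≃ₜ X))
    (hGS : Subgroup.closure (S : Set (X ≃ₜ X)) = G)
    (H : Subgroupoid (GermBase X)) (hH : H.IsWide)
    (hfull : IsAmenableGroup (topologicalFullGroup H hH))
    (hfin : ∀ g ∈ S, {x : X | ¬ GermMem H g x}.Finite)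
    (hrec : ∀ x : X, IsSingularPoint G H x → IsRecurrentOrbitalSchreierGraph G x)
    (hiso : ∀ x : X, IsAmenableGroup (isotropyGroup (germGroupoid G) (germGroupoid_isWide G) x)) :
    IsAmenableGroup G ∧
      (CompactSpace X →
        IsAmenableGroup (topologicalFullGroup (germGroupoid G) (germGroupoid_isWide G))) := by
  classical
  have hfinG : ∀ g ∈ G, {x : X | ¬ GermMem H g x}.Finite := fun g hg =>
    finite_not_germMem_of_mem_closure hH hfin (hGS.symm ▸ hg)
  refine ⟨isAmenableGroup_of_piecewise hH hfull hfinG hrec hiso fun f hf =>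
    ⟨{f}, by simpa using hf, fun x => ⟨f, Finset.mem_singleton_self f, EventuallyEq.rfl⟩⟩,
    fun _ => isAmenableGroup_of_piecewise hH hfull hfinG hrec hiso fun f hf => ?_⟩
  have hloc : ∀ x, ∃ g ∈ G, f =ᶠ[𝓝 x] g := fun x => germMem_germGroupoid_iff.mp (hf x)
  choose g hg hfg using hloc
  -- By compactness, finitely many of the local representatives suffice.
  obtain ⟨t, ht⟩ := CompactSpace.elim_nhds_subcover (fun x => {y | f =ᶠ[𝓝 y] g x}) fun x =>
    eventually_eventually_nhds.mpr (hfg x)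
  refine ⟨t.image g, ?_, fun y => ?_⟩
  · rintro _ hk
    obtain ⟨x, _, rfl⟩ := Finset.mem_image.mp (Finset.mem_coe.mp hk)
    exact hg x
  · have : y ∈ ⋃ x ∈ t, {y | f =ᶠ[𝓝 y] g x} := ht ▸ mem_univ y
    obtain ⟨x, hx, hy⟩ := mem_iUnion₂.mp this
    exact ⟨g x, Finset.mem_image_of_mem g hx, hy⟩
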